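/- Let $a\ne b$ be points of the unit circle $\mathbb{T}$. For $u,v\in\mathbb{T}$ let $(u,v)$ and $[u,v]$ denote the open and the closed arc of $\mathbb{T}$ running counterclockwise from $u$ to $v$. Let $\mu$ be a finite positive Borel measure supported on the arc $[a,b]\subsetneq\mathbb{T}$ (that is, $\mu$ vanishes off $[a,b]$), whose support is infinite; for instance $\operatorname{supp}\mu=[a,b]$. Let $\rho_k$ be the monic orthogonal polynomial of degree $k$ in $L^2_\mu$, and let $\rho_k^*(z)=z^k\,\overline{\rho_k(1/\overline z)}$. Let $n\ge 2$, put $$F_n(z)=\frac{z\,\rho_{n-1}(z)}{\rho_{n-1}^*(z)},$$ and for $\tau\in\mathbb{T}$ consider the paraorthogonal polynomial $$Q_{n,1}(z)=z\,\rho_{n-1}(z)+\tau\,\rho_{n-1}^*(z).$$ Then $Q_{n,1}$ has degree $n$, all its zeros are simple, and 1. all zeros of $Q_{n,1}$ lie in the open arc $(a,b)$ if and only if $-\tau\in(F_n(a),F_n(b))$; 2. all zeros of $Q_{n,1}$ lie in the closed arc $[a,b]$ if and only if $-\tau\in[F_n(a),F_n(b)]$; 3. a point $\alpha\in\mathbb{T}$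 is a zero of $Q_{n,1}$ if and only if $-\tau=F_n(\alpha)$. -/

import Mathlib

open MeasureTheory Polynomial

namespace OPUC

/-- The closed arc `[a, b]` of the unit circle, running counterclockwise from `a` to `b`
(`a`, `b` are points of the unit circle). -/
def closedArc (a b : ℂ) : Set ℂ :=
  {z | ∃ θ t : ℝ, 0 ≤ t ∧ t ≤ θ ∧ θ < 2 * Real.pi ∧
    b = a * Complex.exp (θ * Complex.I) ∧ z = a * Complex.exp (t * Complex.I)}

/-- The open arc `(a, b)` of the unit circle, running counterclockwise from `a` to `b`
(`a`, `b` are points of the unit circle). -/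
def openArc (a b : ℂ) : Set ℂ :=
  {z | ∃ θ t : ℝ, 0 < t ∧ t < θ ∧ θ < 2 * Real.pi ∧
    b = a * Complex.exp (θ * Complex.I) ∧ z = a * Complex.exp (t * Complex.I)}

/-- The inner product `⟨p, q⟩ = ∫ p(z) conj(q(z)) dμ(z)` of two polynomials. -/
noncomputable def innerProd (μ : Measure ℂ) (p q : ℂ[X]) : ℂ :=
  ∫ z, p.eval z * (starRingEnd ℂ) (q.eval z) ∂μ

/-- The monic orthogonal polynomial `ρ_k` of degree `k` in `L²(μ)`, constructed by the
Gram-Schmidt process from the monomials `1, z, z², …`. -/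
noncomputable def monicOP (μ : Measure ℂ) : ℕ → ℂ[X]
  | k => X ^ k - ∑ j : Fin k,
      C (innerProd μ (X ^ k) (monicOP μ j) / innerProd μ (monicOP μ j) (monicOP μ j)) *
        monicOP μ j
termination_by k => k
decreasing_by all_goals exact j.2

/-- The reciprocal `P^*(z) = z^n conj(P(1 / conj z))` of a polynomial `P` of degree at most `n`:
if `P = ∑ p_k z^k` then `P^* = ∑ conj(p_{n-k}) z^k`. -/
noncomputable def reciprocal (n : ℕ) (P : ℂ[X]) : ℂ[X] :=
  ∑ k ∈ Finset.range (n + 1), C ((starRingEnd ℂ) (P.coeff (n - k))) * X ^ k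

/-- The polynomial `Q_{n,1} = z ρ_{n-1} + τ ρ_{n-1}^*` (for `n ≥ 1`). -/
noncomputable def paraOP (μ : Measure ℂ) (n : ℕ) (τ : ℂ) : ℂ[X] :=
  X * monicOP μ (n - 1) + C τ * reciprocal (n - 1) (monicOP μ (n - 1))

/-- The Blaschke product `F_n(z) = z ρ_{n-1}(z) / ρ_{n-1}^*(z)` (for `n ≥ 1`). -/
noncomputable def blaschke (μ : Measure ℂ) (n : ℕ) (z : ℂ) : ℂ :=
  z * (monicOP μ (n - 1)).eval z / (reciprocal (n - 1) (monicOP μ (n - 1))).eval z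

/-- The defining formula of the reciprocal polynomial. -/
theorem reciprocal_eval (n : ℕ) (P : ℂ[X]) (hP : P.natDegree ≤ n) (z : ℂ) (hz : z ≠ 0) :
    (reciprocal n P).eval z =
      z ^ n * (starRingEnd ℂ) (P.eval (1 / (starRingEnd ℂ) z)) := by
  rw [Polynomial.eval_eq_sum_range' (Nat.lt_succ_of_le hP), ← Finset.sum_range_reflect, reciprocal,
    Polynomial.eval_finsetSum, map_sum, Finset.mul_sum]
  refine Finset.sum_congr rfl fun k hk => ?_
  have hk' : k ≤ n := Nat.lt_succ_iff.mp (Finset.mem_range.mp hk)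
  have h1 : n + 1 - 1 - k = n - k := by omega
  have h2 : z ^ n = z ^ k * z ^ (n - k) := by rw [← pow_add]; congr 1; omega
  simp only [Nat.succ_eq_add_one, h1, eval_mul, eval_C, eval_pow, eval_X, map_mul, map_pow,
    map_div₀, map_one, Complex.conj_conj, h2]
  have h3 : z ^ (n - k) * (1 / z) ^ (n - k) = 1 := by
    rw [← mul_pow, mul_one_div_cancel hz, one_pow]
  linear_combination (-(starRingEnd ℂ) (P.coeff (n - k)) * z ^ k) * h3

theorem monicOP_monic (μ : Measure ℂ) (k : ℕ) :
    (monicOP μ k).Monic ∧ (monicOP μ k).natDegree = k := by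
  induction k using Nat.strong_induction_on with
  | _ k ih =>
    have hlt : (∑ j : Fin k,
        C (innerProd μ (X ^ k) (monicOP μ j) / innerProd μ (monicOP μ j) (monicOP μ j)) *
          monicOP μ j).degree < (X ^ k : ℂ[X]).degree := by
      rw [degree_X_pow]
      refine (Polynomial.degree_sum_le _ _).trans_lt ?_
      refine (Finset.sup_lt_iff (WithBot.bot_lt_coe k)).2 fun j _ => ?_
      rw [← smul_eq_C_mul]
      refine (degree_smul_le _ _).trans_lt ?_
      rw [degree_eq_natDegree (ih j j.2).1.ne_zero, (ih j j.2).2]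
      exact Nat.cast_lt.mpr j.2
    rw [monicOP]
    refine ⟨(monic_X_pow k).sub_of_left hlt, ?_⟩
    exact natDegree_eq_of_degree_eq_some (by rw [degree_sub_eq_left_of_degree_lt hlt, degree_X_pow])

section

variable {μ : Measure ℂ} [IsFiniteMeasure μ]

theorem integrable_prod (hμ : μ (Metric.sphere (0 : ℂ) 1)ᶜ = 0) (p q : ℂ[X]) :
    Integrable (fun z => p.eval z * (starRingEnd ℂ) (q.eval z)) μ := by
  have hc : Continuous (fun z : ℂ => p.eval z * (starRingEnd ℂ) (q.eval z)) :=
    p.continuous.mul (Complex.continuous_conj.comp q.continuous)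
  have hr : μ.restrict (Metric.sphere (0 : ℂ) 1) = μ :=
    Measure.restrict_eq_self_of_ae_mem (by
      rw [ae_iff]; exact hμ)
  rw [← hr]
  exact hc.continuousOn.integrableOn_compact (isCompact_sphere 0 1)

theorem innerProd_self_ne_zero (hμ : μ (Metric.sphere (0 : ℂ) 1)ᶜ = 0)
    (hinf : μ.support.Infinite) (p : ℂ[X]) (hp : p ≠ 0) : innerProd μ p p ≠ 0 := by
  intro h
  have e : ∀ z : ℂ, p.eval z * (starRingEnd ℂ) (p.eval z) = ((‖p.eval z‖ ^ 2 : ℝ) : ℂ) := fun z => by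
    rw [Complex.mul_conj, Complex.normSq_eq_norm_sq]
  have hi := integrable_prod hμ p p
  simp only [innerProd, e] at h hi
  rw [integral_complex_ofReal, Complex.ofReal_eq_zero] at h
  have hi' : Integrable (fun z => ‖p.eval z‖ ^ 2) μ := by
    simpa only [RCLike.re_to_complex, Complex.ofReal_re] using hi.re
  rw [integral_eq_zero_iff_of_nonneg (fun z => by positivity) hi'] at h
  refine hinf ((p.roots.toFinset.finite_toSet).subset ?_)
  refine Measure.support_subset_of_isClosed (Finset.finite_toSet _).isClosed ?_
  filter_upwards [h] with z hz
  simpa [hp] using hz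

/-- `ρ_k` is orthogonal to `1, z, …, z^{k-1}`, as soon as `μ` is a finite measure on the unit
circle whose support is infinite. -/
theorem innerProd_monicOP (hμ : μ (Metric.sphere (0 : ℂ) 1)ᶜ = 0)
    (hinf : μ.support.Infinite) (k : ℕ) (q : ℂ[X]) (hq : q.degree < k) :
    innerProd μ (monicOP μ k) q = 0 := by
  have hadd : ∀ p r s : ℂ[X], innerProd μ p (r + s) = innerProd μ p r + innerProd μ p s := by
    intro p r s
    simp only [innerProd]
    rw [← integral_add (integrable_prod hμ p r) (integrable_prod hμ p s)]
    congr 1; ext z; simp; ring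
  have hsub : ∀ p r s : ℂ[X], innerProd μ (p - r) s = innerProd μ p s - innerProd μ r s := by
    intro p r s
    simp only [innerProd]
    rw [← integral_sub (integrable_prod hμ p s) (integrable_prod hμ r s)]
    congr 1; ext z; simp; ring
  have hsmulr : ∀ (c : ℂ) (p r : ℂ[X]),
      innerProd μ p (C c * r) = (starRingEnd ℂ) c * innerProd μ p r := by
    intro c p r
    simp only [innerProd]
    rw [← integral_const_mul]
    congr 1; ext z; simp; ring
  have hsmull : ∀ (c : ℂ) (p r : ℂ[X]), innerProd μ (C c * p) r = c * innerProd μ p r := by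
    intro c p r
    simp only [innerProd]
    rw [← integral_const_mul]
    congr 1; ext z; simp; ring
  have hsuml : ∀ (k : ℕ) (f : Fin k → ℂ[X]) (r : ℂ[X]),
      innerProd μ (∑ j, f j) r = ∑ j, innerProd μ (f j) r := by
    intro k f r
    simp only [innerProd]
    rw [← integral_finsetSum _ (fun j _ => integrable_prod hμ (f j) r)]
    congr 1; ext z; simp [eval_finsetSum, Finset.sum_mul]
  have hconj : ∀ p r : ℂ[X], innerProd μ p r = (starRingEnd ℂ) (innerProd μ r p) := by
    intro p r
    simp only [innerProd]
    rw [← integral_conj]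
    congr 1; ext z; simp; ring
  -- a polynomial orthogonal to `ρ_0, …, ρ_{m-1}` is orthogonal to all of degree `< m`
  have hspan : ∀ (p : ℂ[X]) (m : ℕ), (∀ i < m, innerProd μ p (monicOP μ i) = 0) →
      ∀ q : ℂ[X], q.degree < m → innerProd μ p q = 0 := by
    intro p m
    induction m with
    | zero =>
      intro _ q hq
      have : q = 0 := by
        rw [← degree_eq_bot]; exact Nat.WithBot.lt_zero_iff.mp (by simpa using hq)
      simp [this, innerProd]
    | succ m ih =>
      intro h q hq
      have hd := monicOP_monic μ m
      have hr : (q - C (q.coeff m) * monicOP μ m).degree < m := by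
        rw [degree_lt_iff_coeff_zero]
        intro i hi
        rcases hi.eq_or_lt with rfl | hi
        · have h1 := hd.1.coeff_natDegree
          rw [hd.2] at h1
          simp [h1]
        · have h1 : q.coeff i = 0 := coeff_eq_zero_of_degree_lt (hq.trans_le (by exact_mod_cast hi))
          have h2 : (monicOP μ m).coeff i = 0 :=
            coeff_eq_zero_of_natDegree_lt (by rw [hd.2]; exact hi)
          simp [h1, h2]
      have h3 := ih (fun i hi => h i (hi.trans (Nat.lt_succ_self m))) _ hr
      have h4 : q = (q - C (q.coeff m) * monicOP μ m) + C (q.coeff m) * monicOP μ m := by ring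
      rw [h4, hadd, h3, hsmulr, h m (Nat.lt_succ_self m)]
      simp
  have hne : ∀ i, innerProd μ (monicOP μ i) (monicOP μ i) ≠ 0 := fun i =>
    innerProd_self_ne_zero hμ hinf _ (monicOP_monic μ i).1.ne_zero
  have hdeg : ∀ i, (monicOP μ i).degree = i := fun i => by
    rw [degree_eq_natDegree (monicOP_monic μ i).1.ne_zero, (monicOP_monic μ i).2]
  induction k using Nat.strong_induction_on generalizing q with
  | _ k ih =>
    refine hspan _ k (fun i hi => ?_) q hq
    rw [monicOP, hsub, hsuml, Finset.sum_eq_single (⟨i, hi⟩ : Fin k)]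
    · rw [hsmull, div_mul_cancel₀ _ (hne i), sub_self]
    · intro j _ hj
      rw [hsmull]
      have hij : (j : ℕ) ≠ i := fun h => hj (Fin.ext h)
      rcases lt_or_gt_of_ne hij with hlt | hlt
      · rw [hconj (monicOP μ j) (monicOP μ i),
          ih i hi (monicOP μ j) (by rw [hdeg]; exact_mod_cast hlt)]; simp
      · rw [ih j j.2 (monicOP μ i) (by rw [hdeg]; exact_mod_cast hlt)]; simp
    · intro h; exact absurd (Finset.mem_univ _) h

end

end OPUC

namespace OPUC

open ComplexConjugate

/-! ### Orthogonality and positivity -/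

/-! On the circle, $Q=Q_{n,1}$ is orthogonal to $zR$ for every $R$ of degree at most $n-2$. If
$Q=(z-\alpha)(z-\beta)R$, then $\int (z-\alpha)(z-\beta)\bar z\,|R|^2\,d\mu=0$. This is impossible
when, after multiplication by a constant, $(z-\alpha)(z-\beta)\bar z$ is nonnegative on the support
and vanishes there only at $\alpha,\beta$ (`not_dvd_paraOP`).

Two choices of $\alpha,\beta$ carry the proof. With $\beta=1/\bar\alpha$, the symmetry of the zeros
puts them all on $\mathbb{T}$ and makes them simple. With $\alpha\ne\beta$ both on the complementary
closed arc $[b,a]$, it follows that $Q$ has at most one zero there, for every $\tau$.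

The zeros of $\rho_{n-1}$ lie in the open disc, so $F_n$ is a Blaschke product with a strictly
increasing argument (`exists_arg_blaschke`). By the second choice this argument grows by less than
$2\pi$ along $[b,a]$ (`arg_blaschke_sub_lt`). Hence $F_n$ maps $[b,a]$ bijectively onto the proper
arc $[F_n(b),F_n(a)]$, and $Q$ has a zero in $[b,a]$ exactly when $-\tau$ lies in that image. Taking
complements gives the open-arc claim; leaving out the endpoints gives the closed one. -/

theorem conj_eq_inv_of_norm_eq_one {z : ℂ} (hz : ‖z‖ = 1) : conj z = z⁻¹ := by
  rw [Complex.inv_def, Complex.normSq_eq_norm_sq, hz]; simp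

theorem mul_conj_of_norm_eq_one {z : ℂ} (hz : ‖z‖ = 1) : z * conj z = 1 := by
  rw [Complex.mul_conj, Complex.normSq_eq_norm_sq, hz]; simp

theorem natDegree_reciprocal_le (n : ℕ) (P : ℂ[X]) : (reciprocal n P).natDegree ≤ n := by
  refine natDegree_sum_le_of_forall_le _ _ fun k hk => ?_
  exact (natDegree_C_mul_X_pow_le _ _).trans (Nat.lt_succ_iff.mp (Finset.mem_range.mp hk))

theorem reciprocal_eval_of_norm_eq_one {n : ℕ} {P : ℂ[X]} (hP : P.natDegree ≤ n) {z : ℂ}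
    (hz : ‖z‖ = 1) : (reciprocal n P).eval z = z ^ n * conj (P.eval z) := by
  have hz0 : z ≠ 0 := by rintro rfl; simp at hz
  rw [reciprocal_eval n P hP z hz0, conj_eq_inv_of_norm_eq_one hz, one_div, inv_inv]

theorem ae_norm_eq_one {μ : Measure ℂ} (hμ : μ (Metric.sphere (0 : ℂ) 1)ᶜ = 0) : ∀ᵐ z ∂μ, ‖z‖ = 1 := by
  rw [ae_iff]
  convert hμ using 2
  ext z; simp

section

variable {μ : Measure ℂ} [IsFiniteMeasure μ]

/-- A polynomial whose inner product with some `q` vanishes, although the integrand has, after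
multiplication by a constant, nonnegative real part vanishing only at zeros of `P`, is zero. -/
theorem eq_zero_of_innerProd_eq_zero (hμ : μ (Metric.sphere (0 : ℂ) 1)ᶜ = 0)
    (hinf : μ.support.Infinite) {P q : ℂ[X]} (h : innerProd μ P q = 0) (κ : ℂ)
    (hκ : ∀ᵐ z ∂μ, 0 ≤ (κ * (P.eval z * conj (q.eval z))).re ∧
      ((κ * (P.eval z * conj (q.eval z))).re = 0 → P.eval z = 0)) : P = 0 := by
  by_contra hP
  refine innerProd_self_ne_zero hμ hinf P hP ?_
  have hi : Integrable (fun z => κ * (P.eval z * conj (q.eval z))) μ :=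
    (integrable_prod hμ P q).const_mul κ
  have h1 : ∫ z, (κ * (P.eval z * conj (q.eval z))).re ∂μ = 0 := by
    have := integral_re hi
    simp only [RCLike.re_to_complex] at this
    rw [this, integral_const_mul]
    change (κ * innerProd μ P q).re = 0
    rw [h]; simp
  rw [integral_eq_zero_iff_of_nonneg_ae (hκ.mono fun z hz => hz.1) hi.re] at h1
  have h2 : (fun z => P.eval z * conj (P.eval z)) =ᵐ[μ] 0 := by
    filter_upwards [h1, hκ] with z h3 h4
    simp [h4.2 h3]
  rw [innerProd, integral_congr_ae h2]; simp

/-- The zeros of the orthogonal polynomials lie in the open unit disc. -/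
theorem norm_lt_one_of_isRoot_monicOP (hμ : μ (Metric.sphere (0 : ℂ) 1)ᶜ = 0)
    (hinf : μ.support.Infinite) {m : ℕ} {w : ℂ} (hw : (monicOP μ m).IsRoot w) : ‖w‖ < 1 := by
  by_contra! hw1
  obtain ⟨hmon, hdeg⟩ := monicOP_monic μ m
  obtain ⟨R, hR⟩ := dvd_iff_isRoot.mpr hw
  have hR0 : R ≠ 0 := by rintro rfl; exact hmon.ne_zero (by rw [hR, mul_zero])
  have hdR : R.degree < m := by
    rw [degree_eq_natDegree hR0]
    have : (monicOP μ m).natDegree = 1 + R.natDegree := by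
      rw [hR, natDegree_mul (X_sub_C_ne_zero w) hR0, natDegree_X_sub_C]
    exact_mod_cast (by omega : R.natDegree < m)
  refine hmon.ne_zero (eq_zero_of_innerProd_eq_zero hμ hinf
    (innerProd_monicOP hμ hinf m R hdR) (-w⁻¹) ?_)
  filter_upwards [ae_norm_eq_one hμ] with z hz
  have hw0 : w ≠ 0 := by rintro rfl; simp at hw1; linarith
  -- The constant $-1/w$ turns the factor $z-w$ into $1-z/w$, whose real part is nonnegative for
  -- $|z|=1\le|w|$ and vanishes only at $z=w$.
  have key : -w⁻¹ * ((monicOP μ m).eval z * conj (R.eval z)) =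
      (1 - z / w) * ((‖R.eval z‖ ^ 2 : ℝ) : ℂ) := by
    rw [hR, ← Complex.normSq_eq_norm_sq, ← Complex.mul_conj]
    simp only [eval_mul, eval_sub, eval_X, eval_C]
    field_simp
    ring
  have hq : ‖z / w‖ ≤ 1 := by
    rw [norm_div, hz]; exact div_le_one_of_le₀ hw1 (norm_nonneg _)
  have hre : (z / w).re ≤ 1 := (Complex.re_le_norm _).trans hq
  rw [key, Complex.re_mul_ofReal, Complex.sub_re, Complex.one_re]
  refine ⟨mul_nonneg (by linarith) (by positivity), fun h0 => ?_⟩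
  rcases mul_eq_zero.mp h0 with h1 | h1
  · have h2 : (z / w).re = 1 := by linarith
    have h3 : (z / w).im = 0 := by
      have h4 : (z / w).re ^ 2 + (z / w).im ^ 2 ≤ 1 := by
        have := Complex.sq_norm (z / w)
        rw [Complex.normSq_apply] at this
        nlinarith [norm_nonneg (z / w)]
      rw [h2] at h4
      nlinarith
    have h5 : z / w = 1 := Complex.ext h2 h3
    have h6 : z = w := by rwa [div_eq_one_iff_eq hw0] at h5
    rw [h6]; exact hw
  · have : R.eval z = 0 := by simpa using h1
    rw [hR, eval_mul, this, mul_zero]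

theorem reciprocal_monicOP_eval_ne_zero (hμ : μ (Metric.sphere (0 : ℂ) 1)ᶜ = 0)
    (hinf : μ.support.Infinite) (m : ℕ) {z : ℂ} (hz : ‖z‖ = 1) :
    (reciprocal m (monicOP μ m)).eval z ≠ 0 := by
  have hz0 : z ≠ 0 := by rintro rfl; simp at hz
  rw [reciprocal_eval_of_norm_eq_one (monicOP_monic μ m).2.le hz]
  refine mul_ne_zero (pow_ne_zero _ hz0) ((_root_.map_ne_zero _).mpr fun h => ?_)
  exact (norm_lt_one_of_isRoot_monicOP hμ hinf h).ne hz

/-- On the unit circle, the zeros of `Q_{n,1}` are the points where `F_n = -τ`. -/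
theorem isRoot_paraOP_iff (hμ : μ (Metric.sphere (0 : ℂ) 1)ᶜ = 0)
    (hinf : μ.support.Infinite) (n : ℕ) (τ : ℂ) {z : ℂ} (hz : ‖z‖ = 1) :
    (paraOP μ n τ).IsRoot z ↔ -τ = blaschke μ n z := by
  have h := reciprocal_monicOP_eval_ne_zero hμ hinf (n - 1) hz
  rw [blaschke, eq_div_iff h, IsRoot.def, paraOP]
  simp only [eval_add, eval_mul, eval_X, eval_C]
  constructor <;> intro h <;> linear_combination -h

/-! ### Zeros of the paraorthogonal polynomial -/

theorem paraOP_monic (μ : Measure ℂ) {n : ℕ} (hn : 1 ≤ n) (τ : ℂ) :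
    (paraOP μ n τ).Monic ∧ (paraOP μ n τ).natDegree = n := by
  obtain ⟨hmon, hdeg⟩ := monicOP_monic μ (n - 1)
  have h1 : (X * monicOP μ (n - 1)).Monic := monic_X.mul hmon
  have h2 : (X * monicOP μ (n - 1)).degree = (n : WithBot ℕ) := by
    rw [degree_eq_natDegree h1.ne_zero, natDegree_X_mul hmon.ne_zero, hdeg, Nat.sub_add_cancel hn]
  have h3 : (C τ * reciprocal (n - 1) (monicOP μ (n - 1))).degree < (n : WithBot ℕ) := by
    refine degree_le_natDegree.trans_lt ?_
    have := (natDegree_C_mul_le τ _).trans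
      (natDegree_reciprocal_le (n - 1) (monicOP μ (n - 1)))
    exact_mod_cast (by omega)
  have h4 : (paraOP μ n τ).Monic := h1.add_of_left (h3.trans_eq h2.symm)
  refine ⟨h4, natDegree_eq_of_degree_eq_some ?_⟩
  rw [paraOP, degree_add_eq_left_of_degree_lt (h3.trans_eq h2.symm), h2]

/-- For $|z|=1$, $z\rho\,\overline{zR}=\rho\bar R$ and
$\rho^*\,\overline{zR}=\overline{\rho\,\overline{R^*}}$, with $R^*$ taken in degree $n-2$. Both $R$
and $R^*$ have degree below $n-1$, so both integrals vanish. -/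
theorem innerProd_paraOP (hμ : μ (Metric.sphere (0 : ℂ) 1)ᶜ = 0)
    (hinf : μ.support.Infinite) {n : ℕ} (τ : ℂ) (R : ℂ[X]) (hR : R.natDegree + 2 ≤ n) :
    innerProd μ (paraOP μ n τ) (X * R) = 0 := by
  set ρ := monicOP μ (n - 1) with hρ
  have hdeg : ρ.natDegree ≤ n - 1 := (monicOP_monic μ (n - 1)).2.le
  have h1 : innerProd μ ρ R = 0 := innerProd_monicOP hμ hinf _ _
    (degree_le_natDegree.trans_lt (by exact_mod_cast (by omega)))
  have h2 : innerProd μ ρ (reciprocal (n - 2) R) = 0 := innerProd_monicOP hμ hinf _ _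
    (degree_le_natDegree.trans_lt (by
      have := natDegree_reciprocal_le (n - 2) R
      exact_mod_cast (by omega)))
  have h3 : (fun z => (paraOP μ n τ).eval z * conj ((X * R).eval z)) =ᵐ[μ]
      fun z => ρ.eval z * conj (R.eval z) +
        τ * conj (ρ.eval z * conj ((reciprocal (n - 2) R).eval z)) := by
    filter_upwards [ae_norm_eq_one hμ] with z hz
    have hz1 := mul_conj_of_norm_eq_one hz
    have hpow : z ^ (n - 1) = z ^ (n - 2) * z := by rw [← pow_succ]; congr 1; omega
    rw [paraOP, ← hρ]
    simp only [eval_add, eval_mul, eval_X, eval_C, map_mul, Complex.conj_conj]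
    rw [reciprocal_eval_of_norm_eq_one hdeg hz,
      reciprocal_eval_of_norm_eq_one (by omega : R.natDegree ≤ n - 2) hz, hpow]
    linear_combination (ρ.eval z * conj (R.eval z) +
      τ * z ^ (n - 2) * conj (ρ.eval z) * conj (R.eval z)) * hz1
  rw [innerProd, integral_congr_ae h3, integral_add (integrable_prod hμ _ _), integral_const_mul,
    integral_conj]
  · change innerProd μ ρ R + τ * conj (innerProd μ ρ (reciprocal (n - 2) R)) = 0
    rw [h1, h2]; simp
  · exact ((Complex.conjLIE.toContinuousLinearEquiv.toContinuousLinearMap.integrable_comp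
      (integrable_prod hμ ρ (reciprocal (n - 2) R)))).const_mul τ

/-- `Q_{n,1}` is not divisible by a quadratic polynomial which, up to a rotation and division by
`z`, has constant sign on the support of the measure. -/
theorem not_dvd_paraOP (hμ : μ (Metric.sphere (0 : ℂ) 1)ᶜ = 0)
    (hinf : μ.support.Infinite) {n : ℕ} (hn : 1 ≤ n) (τ : ℂ) {α β : ℂ} (κ : ℂ)
    (hκ : ∀ᵐ z ∂μ, 0 ≤ (κ * ((z - α) * (z - β) * conj z)).re ∧
      ((κ * ((z - α) * (z - β) * conj z)).re = 0 → z = α ∨ z = β)) :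
    ¬ (X - C α) * (X - C β) ∣ paraOP μ n τ := by
  rintro ⟨R, hR⟩
  obtain ⟨hmon, hdeg⟩ := paraOP_monic μ hn τ
  have hR0 : R ≠ 0 := by rintro rfl; exact hmon.ne_zero (by rw [hR, mul_zero])
  have hdR : R.natDegree + 2 ≤ n := by
    rw [← hdeg, hR, natDegree_mul (mul_ne_zero (X_sub_C_ne_zero _) (X_sub_C_ne_zero _)) hR0,
      natDegree_mul (X_sub_C_ne_zero _) (X_sub_C_ne_zero _), natDegree_X_sub_C, natDegree_X_sub_C]
    omega
  refine hmon.ne_zero (eq_zero_of_innerProd_eq_zero hμ hinf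
    (innerProd_paraOP hμ hinf τ R hdR) κ ?_)
  filter_upwards [hκ] with z hz
  have key : κ * ((paraOP μ n τ).eval z * conj ((X * R).eval z)) =
      (κ * ((z - α) * (z - β) * conj z)) * ((‖R.eval z‖ ^ 2 : ℝ) : ℂ) := by
    rw [hR, ← Complex.normSq_eq_norm_sq, ← Complex.mul_conj]
    simp only [eval_mul, eval_sub, eval_X, eval_C, map_mul]
    ring
  rw [key, Complex.re_mul_ofReal]
  refine ⟨mul_nonneg hz.1 (by positivity), fun h0 => ?_⟩
  rw [hR]
  rcases mul_eq_zero.mp h0 with h1 | h1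
  · rcases hz.2 h1 with rfl | rfl <;> simp
  · have : R.eval z = 0 := by simpa using h1
    simp [this]

theorem mul_dvd_of_isRoot {P : ℂ[X]} {α β : ℂ} (hα : P.IsRoot α) (hβ : P.IsRoot β) (h : α ≠ β) :
    (X - C α) * (X - C β) ∣ P :=
  (isCoprime_X_sub_C_of_isUnit_sub (sub_ne_zero.mpr h).isUnit).mul_dvd
    (dvd_iff_isRoot.mpr hα) (dvd_iff_isRoot.mpr hβ)

/-- On the circle $(z-\alpha)(z-1/\bar\alpha)\bar z=-|z-\alpha|^2/\bar\alpha$, so the constant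
$-\bar\alpha$ makes the factor nonnegative. -/
theorem not_reflected_dvd_paraOP (hμ : μ (Metric.sphere (0 : ℂ) 1)ᶜ = 0)
    (hinf : μ.support.Infinite) {n : ℕ} (hn : 1 ≤ n) (τ : ℂ) {α : ℂ} (hα : α ≠ 0) :
    ¬ (X - C α) * (X - C (conj α)⁻¹) ∣ paraOP μ n τ := by
  refine not_dvd_paraOP hμ hinf hn τ (-conj α) ?_
  filter_upwards [ae_norm_eq_one hμ] with z hz
  have hz1 := mul_conj_of_norm_eq_one hz
  have hα' : conj α ≠ 0 := (_root_.map_ne_zero _).mpr hα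
  have key : -conj α * ((z - α) * (z - (conj α)⁻¹) * conj z) = ((‖z - α‖ ^ 2 : ℝ) : ℂ) := by
    rw [← Complex.normSq_eq_norm_sq, ← Complex.mul_conj, map_sub]
    have h2 : conj α * (conj α)⁻¹ = 1 := mul_inv_cancel₀ hα'
    linear_combination (-conj α * (z - α)) * hz1 + (z - α) * conj z * h2
  rw [key, Complex.ofReal_re]
  refine ⟨by positivity, fun h0 => Or.inl ?_⟩
  simpa [sub_eq_zero] using h0

/-- Since $|\tau|=1$, the degree-$n$ reciprocal of $Q$ is $\bar\tau Q$, so the zeros are symmetric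
in the circle. -/
theorem isRoot_paraOP_reflected (μ : Measure ℂ) {n : ℕ} {τ : ℂ} (hτ : ‖τ‖ = 1)
    {α : ℂ} (hα : α ≠ 0) (h : (paraOP μ n τ).IsRoot α) :
    (paraOP μ n τ).IsRoot (conj α)⁻¹ := by
  set ρ := monicOP μ (n - 1) with hρ
  have hdeg : ρ.natDegree ≤ n - 1 := (monicOP_monic μ (n - 1)).2.le
  have hα' : conj α ≠ 0 := (_root_.map_ne_zero _).mpr hα
  have hτ1 := mul_conj_of_norm_eq_one hτ
  rw [IsRoot.def, paraOP, ← hρ] at h ⊢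
  simp only [eval_add, eval_mul, eval_X, eval_C] at h ⊢
  rw [reciprocal_eval _ _ hdeg _ hα] at h
  rw [reciprocal_eval _ _ hdeg _ (inv_ne_zero hα')]
  have h' := congrArg conj h
  simp only [map_add, map_mul, map_pow, Complex.conj_conj, map_zero, map_inv₀, one_div,
    inv_inv] at h' ⊢
  have e : (conj α)⁻¹ ^ (n - 1) * conj α ^ (n - 1) = 1 := by
    rw [← mul_pow, inv_mul_cancel₀ hα', one_pow]
  have e2 : (conj α)⁻¹ * conj α = 1 := inv_mul_cancel₀ hα'
  linear_combination τ * (conj α)⁻¹ ^ (n - 1) * (conj α)⁻¹ * h' -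
    τ * (conj α)⁻¹ ^ (n - 1) * conj (ρ.eval α) * e2 -
    τ * conj τ * (conj α)⁻¹ * ρ.eval (conj α)⁻¹ * e -
    (conj α)⁻¹ * ρ.eval (conj α)⁻¹ * hτ1

theorem norm_eq_one_of_isRoot_paraOP (hμ : μ (Metric.sphere (0 : ℂ) 1)ᶜ = 0)
    (hinf : μ.support.Infinite) {n : ℕ} (hn : 1 ≤ n) {τ : ℂ} (hτ : ‖τ‖ = 1) {α : ℂ}
    (h : (paraOP μ n τ).IsRoot α) : ‖α‖ = 1 := by
  -- As $\rho$ is monic, $\rho^*(0)=1$, hence $Q(0)=\tau\ne0$.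
  have hα : α ≠ 0 := by
    rintro rfl
    obtain ⟨hmon, hdeg⟩ := monicOP_monic μ (n - 1)
    have h1 : (monicOP μ (n - 1)).coeff (n - 1) = 1 := by
      have := hmon.coeff_natDegree; rwa [hdeg] at this
    have h2 : (reciprocal (n - 1) (monicOP μ (n - 1))).eval 0 = 1 := by
      rw [← coeff_zero_eq_eval_zero, reciprocal]
      simp [coeff_X_pow, h1]
    rw [IsRoot.def, paraOP] at h
    simp only [eval_add, eval_mul, eval_X, eval_C, h2, zero_mul, zero_add, mul_one] at h
    simp [h] at hτ
  by_contra hne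
  refine not_reflected_dvd_paraOP hμ hinf hn τ hα
    (mul_dvd_of_isRoot h (isRoot_paraOP_reflected μ hτ hα h) fun h1 => hne ?_)
  have h2 : α * conj α = 1 := by
    nth_rw 1 [h1]
    exact inv_mul_cancel₀ ((_root_.map_ne_zero _).mpr hα)
  rw [Complex.mul_conj, Complex.normSq_eq_norm_sq] at h2
  have h3 : ‖α‖ ^ 2 = 1 := by exact_mod_cast h2
  exact (pow_eq_one_iff_of_nonneg (norm_nonneg _) two_ne_zero).mp h3

theorem nodup_roots_paraOP (hμ : μ (Metric.sphere (0 : ℂ) 1)ᶜ = 0)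
    (hinf : μ.support.Infinite) {n : ℕ} (hn : 1 ≤ n) {τ : ℂ} (hτ : ‖τ‖ = 1) :
    (paraOP μ n τ).roots.Nodup := by
  rw [Multiset.nodup_iff_count_le_one]
  intro α
  by_contra! hc
  rw [count_roots] at hc
  have h0 := (paraOP_monic μ hn τ).1.ne_zero
  have hr : (paraOP μ n τ).IsRoot α := (rootMultiplicity_pos h0).mp (by omega)
  have h1 := norm_eq_one_of_isRoot_paraOP hμ hinf hn hτ hr
  have hα : α ≠ 0 := by rintro rfl; simp at h1
  refine not_reflected_dvd_paraOP hμ hinf hn τ hα ?_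
  -- A point of the circle is its own reflection, so a double zero is a reflected pair.
  rw [conj_eq_inv_of_norm_eq_one h1, inv_inv, ← sq]
  exact (le_rootMultiplicity_iff h0).mp hc

end

/-! ### A continuous argument of the Blaschke product -/

/-- Since $|w|<1$, $1-we^{-it}$ stays in the right half-plane, so the principal argument is
differentiable: it is the imaginary part of the logarithm. -/
theorem hasDerivAt_arg_one_sub_mul_exp {w : ℂ} (hw : ‖w‖ < 1) (θ : ℝ) :
    HasDerivAt (fun t : ℝ => Complex.arg (1 - w * Complex.exp (-(t * Complex.I))))
      (w * Complex.exp (-(θ * Complex.I)) / (1 - w * Complex.exp (-(θ * Complex.I)))).re θ := by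
  have hn : ‖w * Complex.exp (-(θ * Complex.I))‖ < 1 := by
    rw [norm_mul, ← neg_mul, ← Complex.ofReal_neg, Complex.norm_exp_ofReal_mul_I, mul_one]
    exact hw
  have hs : 1 - w * Complex.exp (-(θ * Complex.I)) ∈ Complex.slitPlane := by
    left
    have := (Complex.re_le_norm (w * Complex.exp (-(θ * Complex.I)))).trans_lt hn
    simpa using this
  have h1 : HasDerivAt (fun t : ℝ => 1 - w * Complex.exp (-(t * Complex.I)))
      (Complex.I * (w * Complex.exp (-(θ * Complex.I)))) θ := by
    have h2 : HasDerivAt (fun t : ℝ => -((t : ℂ) * Complex.I)) (-(1 * Complex.I)) θ :=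
      ((Complex.ofRealCLM.hasDerivAt (x := θ)).mul_const Complex.I).neg
    exact ((h2.cexp.const_mul w).const_sub 1).congr_deriv (by ring)
  have h3 := h1.clog_real hs
  have h4 := Complex.imCLM.hasFDerivAt.comp_hasDerivAt θ h3
  simp only [Function.comp_def, Complex.imCLM_apply, Complex.log_im] at h4
  refine h4.congr_deriv ?_
  rw [mul_div_assoc]
  simp

/-- The argument of the Blaschke factor with zero `w`. -/
noncomputable def factorArg (w : ℂ) (t : ℝ) : ℝ :=
  t + 2 * Complex.arg (1 - w * Complex.exp (-(t * Complex.I)))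

theorem continuous_factorArg {w : ℂ} (hw : ‖w‖ < 1) : Continuous (factorArg w) :=
  continuous_id.add (continuous_const.mul (continuous_iff_continuousAt.mpr fun t =>
    (hasDerivAt_arg_one_sub_mul_exp hw t).continuousAt))

theorem re_div_one_sub_gt {v : ℂ} (hv : ‖v‖ < 1) : -1 / 2 < (v / (1 - v)).re := by
  have h1 : Complex.normSq v < 1 := by
    rw [Complex.normSq_eq_norm_sq]; nlinarith [norm_nonneg v]
  have h0 : 1 - v ≠ 0 := by
    intro h; rw [← sub_eq_zero.mp h] at hv; simp at hv
  have h2 := Complex.normSq_pos.mpr h0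
  rw [Complex.div_re, ← add_div, lt_div_iff₀ h2]
  rw [Complex.normSq_apply] at h1 ⊢
  simp only [Complex.sub_re, Complex.sub_im, Complex.one_re, Complex.one_im]
  nlinarith

/-- With $v=we^{-it}$ the derivative is
$1+2\operatorname{Re}\frac{v}{1-v}=\operatorname{Re}\frac{1+v}{1-v}$, the Poisson kernel, which is
positive. -/
theorem strictMono_factorArg {w : ℂ} (hw : ‖w‖ < 1) : StrictMono (factorArg w) := by
  refine strictMono_of_hasDerivAt_pos (fun t => (hasDerivAt_id t).add
    ((hasDerivAt_arg_one_sub_mul_exp hw t).const_mul 2)) fun t => ?_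
  have hn : ‖w * Complex.exp (-(t * Complex.I))‖ < 1 := by
    rw [norm_mul, ← neg_mul, ← Complex.ofReal_neg, Complex.norm_exp_ofReal_mul_I, mul_one]
    exact hw
  have := re_div_one_sub_gt hn
  linarith

theorem exp_two_arg_mul_conj (u : ℂ) : Complex.exp ((2 * u.arg : ℝ) * Complex.I) * conj u = u := by
  have h := Complex.norm_mul_exp_arg_mul_I u
  have h2 : conj u = ‖u‖ * Complex.exp (-(u.arg * Complex.I)) := by
    conv_lhs => rw [← h]
    rw [map_mul, Complex.conj_ofReal, ← Complex.exp_conj, map_mul, Complex.conj_ofReal,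
      Complex.conj_I, mul_neg]
  rw [h2, mul_left_comm, ← Complex.exp_add]
  conv_rhs => rw [← h]
  congr 2; push_cast; ring

/-- With $u=1-we^{-it}$, the left side is $e^{it}u$ and the last factor on the right is $\bar u$;
what remains is $u=e^{2i\arg u}\bar u$. -/
theorem sub_eq_exp_factorArg (w : ℂ) (t : ℝ) :
    Complex.exp (t * Complex.I) - w = Complex.exp (factorArg w t * Complex.I) *
      (Complex.exp (t * Complex.I) * conj (Complex.exp (t * Complex.I) - w)) := by
  have h := exp_two_arg_mul_conj (1 - w * Complex.exp (-(t * Complex.I)))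
  have hc : conj (Complex.exp (t * Complex.I)) = Complex.exp (-(t * Complex.I)) := by
    rw [← Complex.exp_conj, map_mul, Complex.conj_ofReal, Complex.conj_I, mul_neg]
  have hc' : conj (Complex.exp (-(t * Complex.I))) = Complex.exp (t * Complex.I) := by
    rw [← hc, Complex.conj_conj]
  have he : Complex.exp (t * Complex.I) * Complex.exp (-(t * Complex.I)) = 1 := by
    rw [← Complex.exp_add, add_neg_cancel, Complex.exp_zero]
  rw [factorArg, Complex.ofReal_add, add_mul, Complex.exp_add]
  simp only [map_sub, map_one, map_mul, hc, hc'] at h ⊢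
  set E := Complex.exp (t * Complex.I)
  set E' := Complex.exp (-(t * Complex.I))
  set G := Complex.exp ((2 * Complex.arg (1 - w * E') : ℝ) * Complex.I)
  linear_combination (-E) * h + (w - E * G) * he

/-- A product of linear factors with zeros in the open disc has, relative to its reciprocal on the
unit circle, a continuous increasing argument. -/
theorem exists_arg_prod (s : Multiset ℂ) (hs : ∀ w ∈ s, ‖w‖ < 1) :
    ∃ φ : ℝ → ℝ, Continuous φ ∧ Monotone φ ∧ ∀ t : ℝ,
      (s.map fun w => Complex.exp (t * Complex.I) - w).prod =
        Complex.exp (φ t * Complex.I) * (Complex.exp (t * Complex.I) ^ s.card *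
          conj (s.map fun w => Complex.exp (t * Complex.I) - w).prod) := by
  induction s using Multiset.induction with
  | empty => exact ⟨fun _ => 0, continuous_const, monotone_const, fun t => by simp⟩
  | cons w s ih =>
    obtain ⟨φ, hc, hm, h⟩ := ih fun v hv => hs v (Multiset.mem_cons_of_mem hv)
    have hw := hs w (Multiset.mem_cons_self w s)
    refine ⟨fun t => factorArg w t + φ t, (continuous_factorArg hw).add hc,
      (strictMono_factorArg hw).monotone.add hm, fun t => ?_⟩
    rw [Multiset.map_cons, Multiset.prod_cons, Multiset.card_cons, map_mul, Complex.ofReal_add,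
      add_mul, Complex.exp_add, pow_succ]
    conv_lhs => rw [h t, sub_eq_exp_factorArg w t]
    ring

/-! ### Arcs -/

theorem eq_of_exp_eq {s t c : ℝ} (hs : c < s) (hs' : s ≤ c + 2 * Real.pi) (ht : c < t)
    (ht' : t ≤ c + 2 * Real.pi)
    (h : Complex.exp (s * Complex.I) = Complex.exp (t * Complex.I)) : s = t := by
  obtain ⟨k, hk⟩ := Complex.exp_eq_exp_iff_exists_int.mp h
  have hk' : s = t + k * (2 * Real.pi) := by
    have h2 : (s : ℂ) = t + k * (2 * Real.pi) :=
      mul_right_cancel₀ Complex.I_ne_zero (by linear_combination hk)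
    exact_mod_cast h2
  have hpi := Real.pi_pos
  have h1 : k < 1 := by
    by_contra! hc
    have : (1 : ℝ) ≤ k := by exact_mod_cast hc
    nlinarith
  have h2 : -1 < k := by
    by_contra! hc
    have : (k : ℝ) ≤ -1 := by exact_mod_cast hc
    nlinarith
  have : k = 0 := by omega
  rw [hk', this]; simp

theorem exists_eq_mul_exp {u z : ℂ} (hu : ‖u‖ = 1) (hz : ‖z‖ = 1) (c : ℝ) :
    ∃ t : ℝ, c < t ∧ t ≤ c + 2 * Real.pi ∧ z = u * Complex.exp (t * Complex.I) := by
  have hu0 : u ≠ 0 := by rintro rfl; simp at hu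
  refine ⟨toIocMod Real.two_pi_pos c (z / u).arg, (toIocMod_mem_Ioc _ _ _).1,
    (toIocMod_mem_Ioc _ _ _).2, ?_⟩
  have h1 : Complex.exp ((z / u).arg * Complex.I) = z / u := by
    have := Complex.norm_mul_exp_arg_mul_I (z / u)
    rwa [norm_div, hu, hz, div_one, Complex.ofReal_one, one_mul] at this
  have h2 : Complex.exp ((toIocMod Real.two_pi_pos c (z / u).arg : ℝ) * Complex.I) =
      Complex.exp ((z / u).arg * Complex.I) := by
    rw [Complex.exp_eq_exp_iff_exists_int]
    refine ⟨-toIocDiv Real.two_pi_pos c (z / u).arg, ?_⟩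
    rw [toIocMod]; push_cast; simp; ring
  rw [h2, h1, mul_div_cancel₀ _ hu0]

theorem mul_exp_mem_openArc_iff {u : ℂ} (hu : u ≠ 0) {θ t : ℝ} (hθ : 0 < θ)
    (hθ' : θ < 2 * Real.pi) (ht : 0 < t) (ht' : t ≤ 2 * Real.pi) :
    u * Complex.exp (t * Complex.I) ∈ openArc u (u * Complex.exp (θ * Complex.I)) ↔ t < θ := by
  constructor
  · rintro ⟨θ₁, t₁, h1, h2, h3, h4, h5⟩
    have e1 : θ = θ₁ := eq_of_exp_eq (c := 0) hθ (by linarith) (by linarith) (by linarith)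
      (mul_left_cancel₀ hu h4)
    have e2 : t = t₁ := eq_of_exp_eq (c := 0) ht (by linarith) h1 (by linarith)
      (mul_left_cancel₀ hu h5)
    rw [e1, e2]; exact h2
  · intro h
    exact ⟨θ, t, ht, h, hθ', rfl, rfl⟩

/-- Angles are normalised to $(0,2\pi]$, so the initial point $u$ has parameter $2\pi$; this is the
second alternative. -/
theorem mul_exp_mem_closedArc_iff {u : ℂ} (hu : u ≠ 0) {θ t : ℝ} (hθ : 0 < θ)
    (hθ' : θ < 2 * Real.pi) (ht : 0 < t) (ht' : t ≤ 2 * Real.pi) :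
    u * Complex.exp (t * Complex.I) ∈ closedArc u (u * Complex.exp (θ * Complex.I)) ↔
      t ≤ θ ∨ t = 2 * Real.pi := by
  constructor
  · rintro ⟨θ₁, t₁, h1, h2, h3, h4, h5⟩
    rcases h1.eq_or_lt with h1 | h1
    · right
      refine eq_of_exp_eq (c := 0) ht (by linarith) (by positivity) (by linarith) ?_
      rw [mul_left_cancel₀ hu h5, ← h1]
      simp
    · have e1 : θ = θ₁ := eq_of_exp_eq (c := 0) hθ (by linarith) (by linarith) (by linarith)
        (mul_left_cancel₀ hu h4)
      have e2 : t = t₁ := eq_of_exp_eq (c := 0) ht (by linarith) h1 (by linarith)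
        (mul_left_cancel₀ hu h5)
      left; rw [e1, e2]; exact h2
  · rintro (h | rfl)
    · exact ⟨θ, t, ht.le, h, hθ', rfl, rfl⟩
    · exact ⟨θ, 0, le_rfl, hθ.le, hθ', rfl, by simp⟩

/-- A chord is the unit vector at the midpoint angle times $2i$ times a real sine, so signs of
products of chords can be read off. -/
theorem exp_sub_exp (x y : ℝ) : Complex.exp (x * Complex.I) - Complex.exp (y * Complex.I) =
    Complex.exp (((x + y) / 2 : ℝ) * Complex.I) *
      (2 * Complex.I * (Real.sin ((x - y) / 2) : ℝ)) := by
  have hx : Complex.exp (x * Complex.I) = Complex.exp (((x + y) / 2 : ℝ) * Complex.I) *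
      Complex.exp (((x - y) / 2 : ℝ) * Complex.I) := by
    rw [← Complex.exp_add]; congr 1; push_cast; ring
  have hy : Complex.exp (y * Complex.I) = Complex.exp (((x + y) / 2 : ℝ) * Complex.I) *
      Complex.exp (-((x - y) / 2 : ℝ) * Complex.I) := by
    rw [← Complex.exp_add]; congr 1; push_cast; ring
  have hs := Complex.two_sin (((x - y) / 2 : ℝ) : ℂ)
  rw [hx, hy, Complex.ofReal_sin, mul_right_comm, hs]
  linear_combination (Complex.exp (((x + y) / 2 : ℝ) * Complex.I) *
    (Complex.exp (((x - y) / 2 : ℝ) * Complex.I) -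
      Complex.exp (-((x - y) / 2 : ℝ) * Complex.I))) * Complex.I_sq

/-! ### The argument of $F_n$ on the circle and on the complementary arc -/

section

variable {μ : Measure ℂ} [IsFiniteMeasure μ]

/-- The Blaschke product `F_n` has a continuous strictly increasing argument on the circle. -/
theorem exists_arg_blaschke (hμ : μ (Metric.sphere (0 : ℂ) 1)ᶜ = 0)
    (hinf : μ.support.Infinite) (n : ℕ) :
    ∃ ψ : ℝ → ℝ, Continuous ψ ∧ StrictMono ψ ∧ ∀ t : ℝ,
      blaschke μ n (Complex.exp (t * Complex.I)) = Complex.exp (ψ t * Complex.I) := by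
  obtain ⟨hmon, hdeg⟩ := monicOP_monic μ (n - 1)
  obtain ⟨φ, hc, hm, h⟩ := exists_arg_prod (monicOP μ (n - 1)).roots fun w hw =>
    norm_lt_one_of_isRoot_monicOP hμ hinf ((mem_roots hmon.ne_zero).mp hw)
  -- The factor $z$ of $F_n$ contributes $t$, which makes the sum strictly increasing even when
  -- $\rho_{n-1}$ has no zeros.
  refine ⟨fun t => t + φ t, continuous_id.add hc, strictMono_id.add_monotone hm, fun t => ?_⟩
  have hsp := IsAlgClosed.splits (monicOP μ (n - 1))
  have hev : ∀ z, (monicOP μ (n - 1)).eval z =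
      ((monicOP μ (n - 1)).roots.map fun w => z - w).prod := fun z => by
    rw [hsp.eval_eq_prod_roots_of_monic hmon]
  have hcard : (monicOP μ (n - 1)).roots.card = n - 1 := by
    rw [← hsp.natDegree_eq_card_roots, hdeg]
  have hz : ‖Complex.exp (t * Complex.I)‖ = 1 := Complex.norm_exp_ofReal_mul_I t
  have h0 := reciprocal_monicOP_eval_ne_zero hμ hinf (n - 1) hz
  rw [blaschke, div_eq_iff h0, reciprocal_eval_of_norm_eq_one hdeg.le hz, Complex.ofReal_add,
    add_mul, Complex.exp_add]
  have ht := h t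
  rw [← hev, hcard] at ht
  rw [mul_assoc, ← ht]

/-- If the measure lives on the closed arc from `a` to `a e^{iθ}`, then `F_n` takes no value twice
on the complementary arc: its argument increases there by less than `2π`. -/
theorem arg_blaschke_sub_lt {a : ℂ} (ha : ‖a‖ = 1) {θ : ℝ} (hθ : 0 < θ) (hθ' : θ < 2 * Real.pi)
    (hμ : μ (closedArc a (a * Complex.exp (θ * Complex.I)))ᶜ = 0)
    (hμ' : μ (Metric.sphere (0 : ℂ) 1)ᶜ = 0)
    (hinf : μ.support.Infinite) {n : ℕ} (hn : 1 ≤ n) {ψ : ℝ → ℝ} (hc : Continuous ψ)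
    (hψ : ∀ t : ℝ, blaschke μ n (a * Complex.exp (t * Complex.I)) =
      Complex.exp (ψ t * Complex.I)) :
    ψ (2 * Real.pi) - ψ θ < 2 * Real.pi := by
  by_contra! hge
  have hpi := Real.pi_pos
  have ha0 : a ≠ 0 := by rintro rfl; simp at ha
  -- A gain of $2\pi$ or more would give a second point of $[b,a]$ where $F_n$ equals $F_n(b)$,
  -- hence two zeros of one $Q$ on that arc.
  obtain ⟨t, ⟨ht, ht'⟩, h⟩ := intermediate_value_Icc hθ'.le hc.continuousOn
    (show ψ θ + 2 * Real.pi ∈ Set.Icc (ψ θ) (ψ (2 * Real.pi)) by constructor <;> linarith)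
  have hlt : θ < t := lt_of_le_of_ne ht (by rintro rfl; linarith)
  have hnorm : ∀ x : ℝ, ‖a * Complex.exp (x * Complex.I)‖ = 1 := fun x => by
    rw [norm_mul, ha, Complex.norm_exp_ofReal_mul_I, one_mul]
  set τ := -blaschke μ n (a * Complex.exp (θ * Complex.I)) with hτ
  have hr1 : (paraOP μ n τ).IsRoot (a * Complex.exp (θ * Complex.I)) := by
    rw [isRoot_paraOP_iff hμ' hinf n τ (hnorm θ), hτ, neg_neg]
  have hr2 : (paraOP μ n τ).IsRoot (a * Complex.exp (t * Complex.I)) := by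
    rw [isRoot_paraOP_iff hμ' hinf n τ (hnorm t), hτ, neg_neg, hψ, hψ, h, Complex.ofReal_add,
      add_mul, Complex.exp_add]
    simp [Complex.exp_two_pi_mul_I]
  have hne : a * Complex.exp (θ * Complex.I) ≠ a * Complex.exp (t * Complex.I) := fun e =>
    hlt.ne (eq_of_exp_eq (c := 0) hθ (by linarith) (by linarith) (by linarith)
      (mul_left_cancel₀ ha0 e))
  -- The constant cancels the phases of the two chords, and its minus sign cancels that of $(2i)^2$.
  refine not_dvd_paraOP hμ' hinf hn τ
    (-(conj a * Complex.exp (-(((θ + t) / 2 : ℝ) * Complex.I)))) ?_ (mul_dvd_of_isRoot hr1 hr2 hne)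
  have hae : ∀ᵐ z ∂μ, z ∈ closedArc a (a * Complex.exp (θ * Complex.I)) := hμ
  filter_upwards [hae] with z hz
  obtain ⟨θ₁, x, hx, hx', h3, h4, rfl⟩ := hz
  -- The angle in `closedArc` is existential and must be matched with $\theta$; the value $0$ would
  -- make the endpoints coincide.
  have e1 : θ = θ₁ := by
    rcases (hx.trans hx').eq_or_lt with h0 | h0
    · exfalso
      rw [← h0] at h4
      have h5 := mul_left_cancel₀ ha0 h4
      have h6 := eq_of_exp_eq (s := θ) (t := 2 * Real.pi) (c := 0) hθ (by linarith) (by linarith)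
        (by linarith) (by rw [h5]; simp [Complex.exp_two_pi_mul_I])
      linarith
    · exact eq_of_exp_eq (c := 0) hθ (by linarith) h0 (by linarith) (mul_left_cancel₀ ha0 h4)
  rw [← e1] at hx'
  have key : -(conj a * Complex.exp (-(((θ + t) / 2 : ℝ) * Complex.I))) *
      ((a * Complex.exp (x * Complex.I) - a * Complex.exp (θ * Complex.I)) *
        (a * Complex.exp (x * Complex.I) - a * Complex.exp (t * Complex.I)) *
          conj (a * Complex.exp (x * Complex.I))) =
      ((4 * (Real.sin ((x - θ) / 2) * Real.sin ((x - t) / 2)) : ℝ) : ℂ) := by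
    have hax := mul_conj_of_norm_eq_one ha
    have hexp : Complex.exp (-(((θ + t) / 2 : ℝ) * Complex.I)) *
        (Complex.exp (((x + θ) / 2 : ℝ) * Complex.I) *
          (Complex.exp (((x + t) / 2 : ℝ) * Complex.I) * conj (Complex.exp (x * Complex.I)))) = 1 := by
      rw [← Complex.exp_conj, ← Complex.exp_add, ← Complex.exp_add, ← Complex.exp_add,
        Complex.exp_eq_one_iff]
      refine ⟨0, ?_⟩
      simp only [map_mul, Complex.conj_ofReal, Complex.conj_I]
      push_cast
      ring
    rw [← mul_sub, ← mul_sub, exp_sub_exp, exp_sub_exp, map_mul]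
    push_cast at hexp ⊢
    generalize Complex.sin ((x - θ) / 2) = S1
    generalize Complex.sin ((x - t) / 2) = S2
    calc _ = -4 * Complex.I ^ 2 * (S1 * S2) * (a * conj a) ^ 2 * (Complex.exp (-((θ + t) / 2 * Complex.I)) *
        (Complex.exp ((x + θ) / 2 * Complex.I) *
          (Complex.exp ((x + t) / 2 * Complex.I) * conj (Complex.exp (x * Complex.I))))) := by ring
      _ = _ := by rw [hexp, hax, Complex.I_sq]; ring
  rw [key, Complex.ofReal_re]
  -- As $0\le x\le\theta<t\le2\pi$, both half-angles lie in $[-\pi,0]$.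
  have hs1 : Real.sin ((x - θ) / 2) ≤ 0 :=
    Real.sin_nonpos_of_nonpos_of_neg_pi_le (by linarith) (by linarith)
  have hs2 : Real.sin ((x - t) / 2) ≤ 0 :=
    Real.sin_nonpos_of_nonpos_of_neg_pi_le (by linarith) (by linarith)
  refine ⟨by nlinarith [mul_nonneg_of_nonpos_of_nonpos hs1 hs2], fun h0 => ?_⟩
  have h5 := (mul_eq_zero.mp h0).resolve_left (by norm_num)
  rw [← sub_eq_zero, ← sub_eq_zero (a := _ * _) (b := a * Complex.exp (t * Complex.I)), ← mul_sub,
    ← mul_sub, exp_sub_exp, exp_sub_exp]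
  rcases mul_eq_zero.mp h5 with h6 | h6 <;> rw [h6] <;> simp

end

theorem closedArc_subset_sphere {a : ℂ} (ha : ‖a‖ = 1) (b : ℂ) :
    closedArc a b ⊆ Metric.sphere (0 : ℂ) 1 := by
  rintro z ⟨θ, t, -, -, -, -, rfl⟩
  rw [mem_sphere_zero_iff_norm, norm_mul, ha, Complex.norm_exp_ofReal_mul_I, one_mul]

end OPUC

/-! ### Locating the zeros by the argument of $F_n$ -/

theorem theorem3p4 (μ : Measure ℂ) [IsFiniteMeasure μ] (a b : ℂ) (ha : ‖a‖ = 1) (hb : ‖b‖ = 1)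
    (hab : a ≠ b) (hμ : μ (OPUC.closedArc a b)ᶜ = 0) (hinf : μ.support.Infinite)
    (n : ℕ) (hn : 2 ≤ n) (τ : ℂ) (hτ : ‖τ‖ = 1) :
    -- the polynomial has exactly `n` zeros, all of them simple
    ((OPUC.paraOP μ n τ).natDegree = n ∧ (OPUC.paraOP μ n τ).roots.Nodup) ∧
    -- all zeros lie in the open arc
    ((∀ z, (OPUC.paraOP μ n τ).IsRoot z → z ∈ OPUC.openArc a b) ↔
      -τ ∈ OPUC.openArc (OPUC.blaschke μ n a) (OPUC.blaschke μ n b)) ∧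
    -- all zeros lie in the closed arc
    ((∀ z, (OPUC.paraOP μ n τ).IsRoot z → z ∈ OPUC.closedArc a b) ↔
      -τ ∈ OPUC.closedArc (OPUC.blaschke μ n a) (OPUC.blaschke μ n b)) ∧
    -- the zeros on the unit circle
    (∀ α : ℂ, ‖α‖ = 1 →
      ((OPUC.paraOP μ n τ).IsRoot α ↔ -τ = OPUC.blaschke μ n α)) := by
  have hn1 : 1 ≤ n := by omega
  have hS : μ (Metric.sphere (0 : ℂ) 1)ᶜ = 0 :=
    measure_mono_null (Set.compl_subset_compl.mpr (OPUC.closedArc_subset_sphere ha b)) hμ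
  have hroot := fun (z : ℂ) (hz : ‖z‖ = 1) => OPUC.isRoot_paraOP_iff hS hinf n τ hz
  have hpi := Real.pi_pos
  have ha0 : a ≠ 0 := by rintro rfl; simp at ha
  -- angular parameters relative to `a`
  obtain ⟨θ, hθ, hθ2, rfl⟩ := OPUC.exists_eq_mul_exp ha hb 0
  rw [zero_add] at hθ2
  have hθ' : θ < 2 * Real.pi := lt_of_le_of_ne hθ2 (by
    rintro rfl
    exact hab (by simp [Complex.exp_two_pi_mul_I]))
  obtain ⟨ψ₀, hc₀, hm₀, h₀⟩ := OPUC.exists_arg_blaschke hS hinf n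
  obtain ⟨ψ, hc, hm, hψ⟩ : ∃ ψ : ℝ → ℝ, Continuous ψ ∧ StrictMono ψ ∧ ∀ t : ℝ,
      OPUC.blaschke μ n (a * Complex.exp (t * Complex.I)) = Complex.exp (ψ t * Complex.I) := by
    refine ⟨fun t => ψ₀ (a.arg + t), hc₀.comp (continuous_const.add continuous_id),
      hm₀.comp (fun x y h => by simpa using h), fun t => ?_⟩
    rw [← h₀, Complex.ofReal_add, add_mul, Complex.exp_add]
    have := Complex.norm_mul_exp_arg_mul_I a
    rw [ha, Complex.ofReal_one, one_mul] at this
    rw [this]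
  have hlt := OPUC.arg_blaschke_sub_lt ha hθ hθ' hμ hS hinf hn1 hc hψ
  -- the values of `F_n` at the endpoints
  have hFa : OPUC.blaschke μ n a = Complex.exp (ψ (2 * Real.pi) * Complex.I) := by
    rw [← hψ]; simp [Complex.exp_two_pi_mul_I]
  -- This is the counterclockwise angle from $F_n(a)$ to $F_n(b)$; it lies in $(0,2\pi)$ by `hlt`
  -- and monotonicity.
  set Θ := ψ θ - ψ (2 * Real.pi) + 2 * Real.pi with hΘ
  have hmθ := hm hθ'
  have hFb : OPUC.blaschke μ n (a * Complex.exp (θ * Complex.I)) =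
      OPUC.blaschke μ n a * Complex.exp (Θ * Complex.I) := by
    rw [hψ, hFa, ← Complex.exp_add, Complex.exp_eq_exp_iff_exists_int]
    exact ⟨-1, by rw [hΘ]; push_cast; ring⟩
  have hFa1 : ‖OPUC.blaschke μ n a‖ = 1 := by rw [hFa, Complex.norm_exp_ofReal_mul_I]
  have hFa0 : OPUC.blaschke μ n a ≠ 0 := by intro h; simp [h] at hFa1
  obtain ⟨s, hs, hs', hτs⟩ := OPUC.exists_eq_mul_exp hFa1 (z := -τ) (by rwa [norm_neg]) 0
  rw [zero_add] at hs'
  -- zeros on the arc complementary to the open arc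
  have hcompl : ∀ t : ℝ, θ ≤ t → t ≤ 2 * Real.pi →
      ((OPUC.paraOP μ n τ).IsRoot (a * Complex.exp (t * Complex.I)) ↔
        ψ t = ψ (2 * Real.pi) + s - 2 * Real.pi) := by
    intro t ht ht'
    rw [hroot _ (by rw [norm_mul, ha, Complex.norm_exp_ofReal_mul_I, one_mul]), hτs, hψ, hFa,
      ← Complex.exp_add]
    have e : Complex.exp (ψ (2 * Real.pi) * Complex.I + s * Complex.I) =
        Complex.exp ((ψ (2 * Real.pi) + s - 2 * Real.pi : ℝ) * Complex.I) := by
      rw [Complex.exp_eq_exp_iff_exists_int]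
      exact ⟨1, by push_cast; ring⟩
    rw [e]
    -- Both arguments lie in the half-open window $(\psi(2\pi)-2\pi,\psi(2\pi)]$, where equal
    -- exponentials force equality: $\psi(t)$ because the gain is below $2\pi$, the other because
    -- $0<s\le2\pi$.
    have h1 := hm.monotone ht
    have h2 := hm.monotone ht'
    refine ⟨fun h => (OPUC.eq_of_exp_eq (c := ψ (2 * Real.pi) - 2 * Real.pi) ?_ ?_ ?_ ?_ h).symm,
      fun h => by rw [h]⟩ <;> linarith
  have hivt : ∀ y, ψ θ ≤ y → y ≤ ψ (2 * Real.pi) → ∃ t, θ ≤ t ∧ t ≤ 2 * Real.pi ∧ ψ t = y := by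
    intro y h1 h2
    obtain ⟨t, ⟨h3, h4⟩, h5⟩ := intermediate_value_Icc hθ'.le hc.continuousOn ⟨h1, h2⟩
    exact ⟨t, h3, h4, h5⟩
  have hparam : ∀ z, (OPUC.paraOP μ n τ).IsRoot z →
      ∃ t : ℝ, 0 < t ∧ t ≤ 2 * Real.pi ∧ z = a * Complex.exp (t * Complex.I) := fun z hz => by
    simpa using OPUC.exists_eq_mul_exp ha
      (OPUC.norm_eq_one_of_isRoot_paraOP hS hinf hn1 hτ hz) 0
  refine ⟨⟨(OPUC.paraOP_monic μ hn1 τ).2, OPUC.nodup_roots_paraOP hS hinf hn1 hτ⟩, ?_, ?_, hroot⟩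
  · rw [hFb, hτs, OPUC.mul_exp_mem_openArc_iff hFa0 (by linarith) (by linarith) hs hs']
    constructor
    · intro h
      by_contra! hge
      -- If $s\ge\Theta$, the target value lies between $\psi(\theta)$ and $\psi(2\pi)$, so $Q$ has
      -- a zero on $[b,a]$.
      obtain ⟨t, h1, h2, h3⟩ := hivt (ψ (2 * Real.pi) + s - 2 * Real.pi) (by linarith) (by linarith)
      have h4 := h _ ((hcompl t h1 h2).mpr h3)
      rw [OPUC.mul_exp_mem_openArc_iff ha0 hθ hθ' (by linarith) h2] at h4
      linarith
    · intro h z hz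
      obtain ⟨t, h1, h2, rfl⟩ := hparam z hz
      rw [OPUC.mul_exp_mem_openArc_iff ha0 hθ hθ' h1 h2]
      by_contra! hge
      have h3 := (hcompl t hge h2).mp hz
      have h4 := hm.monotone hge
      linarith
  · rw [hFb, hτs, OPUC.mul_exp_mem_closedArc_iff hFa0 (by linarith) (by linarith) hs hs']
    constructor
    · intro h
      by_contra! hge
      have hs2 := lt_of_le_of_ne hs' hge.2
      obtain ⟨t, h1, h2, h3⟩ := hivt (ψ (2 * Real.pi) + s - 2 * Real.pi) (by linarith) (by linarith)
      have h4 := h _ ((hcompl t h1 h2).mpr h3)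
      rw [OPUC.mul_exp_mem_closedArc_iff ha0 hθ hθ' (by linarith) h2] at h4
      -- The zero could lie in $[a,b]$ only at $b$ or $a$, that is, for $s=\Theta$ or $s=2\pi$; both
      -- are excluded.
      rcases h4 with h4 | h4
      · have : t = θ := le_antisymm h4 h1
        rw [this] at h3
        linarith [hge.1]
      · rw [h4] at h3
        linarith
    · intro h z hz
      obtain ⟨t, h1, h2, rfl⟩ := hparam z hz
      rw [OPUC.mul_exp_mem_closedArc_iff ha0 hθ hθ' h1 h2]
      by_contra! hge
      have h3 := (hcompl t hge.1.le h2).mp hz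
      have h4 := hm hge.1
      have h5 := hm (lt_of_le_of_ne h2 hge.2)
      rcases h with h | h <;> linarith
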